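/- Let $p>2$ be a prime and let $r,s,t$ be positive integers. Then $$\sum_{m_1=0}^{rp-1}\sum_{m_2=0}^{sp-1}\sum_{m_3=0}^{tp-1}\binom{m_1+m_2+m_3}{m_1,m_2,m_3}\equiv\sum_{m_1=0}^{r-1}\sum_{m_2=0}^{s-1}\sum_{m_3=0}^{t-1}\binom{m_1+m_2+m_3}{m_1,m_2,m_3}\pmod{p^3},$$ where $\binom{m_1+m_2+m_3}{m_1,m_2,m_3}=\frac{(m_1+m_2+m_3)!}{m_1!\,m_2!\,m_3!}$ is the trinomial coefficient. -/

import Mathlib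

open MvPolynomial

/-! With `P = x + y + z`, a box sum is one coefficient of `∏ (P^r - x^r) / (P - x)`. Put `u = y +
z`, `v = z + x`, `w = x + y`. Since `p` is odd, `P^p = e + p h` with `e = x^p + y^p + z^p` and `h =
u v w k`, `deg k ≤ p - 3`. Splitting `P^(rp) - x^(rp)` at `e^r` and dividing by `u` makes each
factor `q(X^p) c + p v w k g`, where `c = (y^p + z^p) / u`. As `c u` is a polynomial in the `p`-th
powers, the product modulo `p^3` is a main term plus polynomials in `X^p` times `k` or `k h`. The
target exponents are `-1` modulo `p`, so those corrections have degree too small to contribute. The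
main term gives the small box sum times the coefficient of `(xyz)^(p-1)` in the product of the three
`c`, which is 1. -/

/-- Expansion modulo `p ^ 3` in which every correction term is `k` or `k * h` times an expression in
the `q`, `U`, `V`, `W`, `A`, `B` alone. -/
theorem exists_product_expansion_mod_cube {R : Type*} [CommRing R] (p u v w k q₁ q₂ q₃ c₁ c₂ c₃
    A₁ A₂ A₃ B₁ B₂ B₃ C₁ C₂ C₃ h U V W g₁ g₂ g₃ : R)
    (hh : h = u * v * w * k) (hU : U = c₁ * u) (hV : V = c₂ * v) (hW : W = c₃ * w)
    (hg₁ : g₁ = A₁ + p * h * B₁ + p ^ 2 * C₁) (hg₂ : g₂ = A₂ + p * h * B₂ + p ^ 2 * C₂)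
    (hg₃ : g₃ = A₃ + p * h * B₃ + p ^ 2 * C₃) :
    ∃ T, (q₁ * c₁ + p * (v * w) * k * g₁) * (q₂ * c₂ + p * (u * w) * k * g₂) *
      (q₃ * c₃ + p * (u * v) * k * g₃) =
    q₁ * q₂ * q₃ * (c₁ * c₂ * c₃) +
    p * (q₂ * q₃ * V * W * A₁ + q₁ * q₃ * U * W * A₂ + q₁ * q₂ * U * V * A₃) * k +
    p ^ 2 * (q₂ * q₃ * V * W * B₁ + q₁ * q₃ * U * W * B₂ + q₁ * q₂ * U * V * B₃ +
      q₃ * W * A₁ * A₂ + q₂ * V * A₁ * A₃ + q₁ * U * A₂ * A₃) * (k * h) +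
    p ^ 3 * T := by
  -- Here `g₁ * g₂ - A₁ * A₂ = (g₁ - A₁) * g₂ + A₁ * (g₂ - A₂)`, and each `gᵢ - Aᵢ` is divisible by
  -- `p`.
  refine ⟨(k * (q₂ * q₃ * V * W * C₁ + q₁ * q₃ * U * W * C₂ + q₁ * q₂ * U * V * C₃) +
      k * h * (q₃ * W * ((h * B₁ + p * C₁) * g₂ + A₁ * (h * B₂ + p * C₂)) +
        q₂ * V * ((h * B₁ + p * C₁) * g₃ + A₁ * (h * B₃ + p * C₃)) +
        q₁ * U * ((h * B₂ + p * C₂) * g₃ + A₂ * (h * B₃ + p * C₃))) +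
      k * h ^ 2 * (g₁ * g₂ * g₃)), ?_⟩
  have e₁ : p * (h * B₁ + p * C₁) = g₁ - A₁ := by rw [hg₁]; ring
  have e₂ : p * (h * B₂ + p * C₂) = g₂ - A₂ := by rw [hg₂]; ring
  have e₃ : p * (h * B₃ + p * C₃) = g₃ - A₃ := by rw [hg₃]; ring
  clear hg₁ hg₂ hg₃
  subst hU hV hW hh
  linear_combination (-p * k * (q₂ * q₃ * c₂ * v * c₃ * w)) * e₁
    + (-p * k * (q₁ * q₃ * c₁ * u * c₃ * w)) * e₂ + (-p * k * (q₁ * q₂ * c₁ * u * c₂ * v)) * e₃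
    - p ^ 2 * k * (u * v * w * k) * (q₃ * (c₃ * w) * (e₁ * g₂ + A₁ * e₂)
      + q₂ * (c₂ * v) * (e₁ * g₃ + A₁ * e₃) + q₁ * (c₁ * u) * (e₂ * g₃ + A₂ * e₃))

/-! ### Box sums as coefficients -/

/-- The exponent vector of the monomial `X 0 ^ a * X 1 ^ b * X 2 ^ c`. -/
noncomputable def tripleExponent (a b c : ℕ) : Fin 3 →₀ ℕ := Finsupp.equivFunOnFinite.symm ![a, b, c]

theorem tripleExponent_add (a b c a' b' c' : ℕ) :
    tripleExponent a b c + tripleExponent a' b' c' = tripleExponent (a + a') (b + b') (c + c') := by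
  ext i; fin_cases i <;> simp [tripleExponent]

theorem monomial_tripleExponent (a b c : ℕ) :
    (monomial (tripleExponent a b c) 1 : MvPolynomial (Fin 3) ℤ) = X 0 ^ a * X 1 ^ b * X 2 ^ c := by
  rw [monomial_eq, Finsupp.prod_fintype _ _ (by simp)]
  simp [Fin.prod_univ_three, tripleExponent]

theorem tripleExponent_inj {a b c a' b' c' : ℕ} :
    tripleExponent a b c = tripleExponent a' b' c' ↔ a = a' ∧ b = b' ∧ c = c' := by
  refine ⟨fun h => ⟨?_, ?_, ?_⟩, by rintro ⟨rfl, rfl, rfl⟩; rfl⟩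
  · simpa [tripleExponent] using DFunLike.congr_fun h 0
  · simpa [tripleExponent] using DFunLike.congr_fun h 1
  · simpa [tripleExponent] using DFunLike.congr_fun h 2

theorem coeff_sum_X_pow_eq_multinomial {σ : Type*} [Fintype σ] [DecidableEq σ] (m : σ →₀ ℕ) :
    coeff m ((∑ i, X i : MvPolynomial σ ℤ) ^ (∑ i, m i)) = Nat.multinomial Finset.univ m := by
  rw [Finset.sum_pow_eq_sum_piAntidiag, coeff_sum, Finset.sum_eq_single ⇑m]
  · rw [← map_natCast (C : ℤ →+* MvPolynomial σ ℤ), coeff_C_mul]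
    have : (∏ i, X i ^ m i : MvPolynomial σ ℤ) = monomial m 1 := by
      rw [monomial_eq, Finsupp.prod_fintype _ _ (by simp)]; simp
    simp [this]
  · intro b _ hb
    rw [← map_natCast (C : ℤ →+* MvPolynomial σ ℤ), coeff_C_mul]
    have : (∏ i, X i ^ b i : MvPolynomial σ ℤ) = monomial (Finsupp.equivFunOnFinite.symm b) 1 := by
      rw [monomial_eq, Finsupp.prod_fintype _ _ (by simp)]; simp
    rw [this, coeff_monomial, if_neg, mul_zero]
    rintro rfl
    exact hb rfl
  · simp

/-- The homogeneous form of `(u ^ n - v ^ n) / (u - v)`. -/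
def geomQuot {R : Type*} [CommRing R] (u v : R) (n : ℕ) : R :=
  ∑ i ∈ Finset.range n, u ^ i * v ^ (n - 1 - i)

theorem geomQuot_mul {R : Type*} [CommRing R] (u v : R) (n : ℕ) :
    geomQuot u v n * (u - v) = u ^ n - v ^ n := (Commute.all u v).geom_sum₂_mul n

theorem map_geomQuot {R S : Type*} [CommRing R] [CommRing S] (f : R →+* S) (u v : R) (n : ℕ) :
    f (geomQuot u v n) = geomQuot (f u) (f v) n := by simp [geomQuot]

theorem sum_mul_sum_mul_sum {ι R : Type*} [CommRing R] (s t u : Finset ι) (f g h : ι → R) :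
    (∑ i ∈ s, f i) * (∑ j ∈ t, g j) * ∑ k ∈ u, h k =
      ∑ i ∈ s, ∑ j ∈ t, ∑ k ∈ u, f i * g j * h k := by
  rw [Finset.sum_mul_sum, Finset.sum_mul]
  refine Finset.sum_congr rfl fun i _ => ?_
  rw [Finset.sum_mul]
  exact Finset.sum_congr rfl fun j _ => Finset.mul_sum _ _ _

/-- With `P = X 0 + X 1 + X 2`, a box sum of trinomial coefficients is a single coefficient of
`∏ (P ^ r - X i ^ r) / (P - X i)`. -/
theorem coeff_geomQuot_eq_sum_multinomial (r s t : ℕ) :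
    coeff (tripleExponent (r - 1) (s - 1) (t - 1))
      (geomQuot (X 0 + X 1 + X 2 : MvPolynomial (Fin 3) ℤ) (X 0) r *
        geomQuot (X 0 + X 1 + X 2) (X 1) s * geomQuot (X 0 + X 1 + X 2) (X 2) t) =
    ∑ m₁ ∈ Finset.range r, ∑ m₂ ∈ Finset.range s, ∑ m₃ ∈ Finset.range t,
      (Nat.multinomial Finset.univ ![m₁, m₂, m₃] : ℤ) := by
  simp only [geomQuot, sum_mul_sum_mul_sum, coeff_sum]
  refine Finset.sum_congr rfl fun i hi => Finset.sum_congr rfl fun j hj =>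
    Finset.sum_congr rfl fun k hk => ?_
  rw [Finset.mem_range] at hi hj hk
  have h1 : ((X 0 + X 1 + X 2 : MvPolynomial (Fin 3) ℤ) ^ i * X 0 ^ (r - 1 - i) *
      ((X 0 + X 1 + X 2) ^ j * X 1 ^ (s - 1 - j)) * ((X 0 + X 1 + X 2) ^ k * X 2 ^ (t - 1 - k))) =
      (∑ l, X l) ^ (∑ l, tripleExponent i j k l) *
        monomial (tripleExponent (r - 1 - i) (s - 1 - j) (t - 1 - k)) 1 := by
    rw [monomial_tripleExponent]
    simp only [Fin.sum_univ_three, tripleExponent, Finsupp.equivFunOnFinite_symm_apply_apply,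
      Matrix.cons_val_zero, Matrix.cons_val_one, Matrix.cons_val]
    ring
  have h2 : tripleExponent (r - 1) (s - 1) (t - 1) =
      tripleExponent i j k + tripleExponent (r - 1 - i) (s - 1 - j) (t - 1 - k) := by
    rw [tripleExponent_add, tripleExponent_inj]; omega
  rw [h1, h2, coeff_mul_monomial, mul_one, coeff_sum_X_pow_eq_multinomial]
  rfl

/-- `S` will be the ring of polynomials in the `p`-th powers; only `C` may leave it. -/
theorem exists_eq_add_mul_pow_expansion {R : Type*} [CommRing R] (S : Subring R) {e : R} (he : e ∈ S)
    (η : R) (n : ℕ) : ∃ A ∈ S, ∃ B ∈ S, ∃ C, (e + η) ^ n = A + η * B + η ^ 2 * C := by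
  induction n with
  | zero => exact ⟨1, S.one_mem, 0, S.zero_mem, 0, by simp⟩
  | succ n ih =>
    obtain ⟨A, hA, B, hB, C, h⟩ := ih
    exact ⟨A * e, S.mul_mem hA he, A + B * e, S.add_mem hA (S.mul_mem hB he), B + C * (e + η), by
      rw [pow_succ, h]; ring⟩

theorem exists_geomQuot_expansion {R : Type*} [CommRing R] (S : Subring R) {e : R} (he : e ∈ S)
    (η : R) (n : ℕ) : ∃ A ∈ S, ∃ B ∈ S, ∃ C, geomQuot (e + η) e n = A + η * B + η ^ 2 * C := by
  choose A hA B hB C h using exists_eq_add_mul_pow_expansion S he η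
  refine ⟨∑ i ∈ Finset.range n, A i * e ^ (n - 1 - i), S.sum_mem fun i _ => S.mul_mem (hA i) (S.pow_mem he _),
    ∑ i ∈ Finset.range n, B i * e ^ (n - 1 - i), S.sum_mem fun i _ => S.mul_mem (hB i) (S.pow_mem he _),
    ∑ i ∈ Finset.range n, C i * e ^ (n - 1 - i), ?_⟩
  simp only [geomQuot, Finset.mul_sum, ← Finset.sum_add_distrib]
  exact Finset.sum_congr rfl fun i _ => by rw [h i]; ring

/-! ### The `p`-th power of the sum of the variables -/

/-- Modulo `X i + X j` the substitution `X i ↦ -X j` changes nothing. -/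
theorem X_add_X_dvd_of_aeval_eq_zero {σ : Type*} [DecidableEq σ] {i j : σ} (f : MvPolynomial σ ℤ)
    (h : aeval (Function.update X i (-X j) : σ → MvPolynomial σ ℤ) f = 0) : X i + X j ∣ f := by
  rw [← Ideal.mem_span_singleton, ← Ideal.Quotient.eq_zero_iff_mem]
  set I := Ideal.span {(X i + X j : MvPolynomial σ ℤ)}
  have : (Ideal.Quotient.mkₐ ℤ I).comp (aeval (Function.update X i (-X j) : σ → MvPolynomial σ ℤ)) =
      Ideal.Quotient.mkₐ ℤ I := by
    ext l
    by_cases hl : l = i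
    · subst hl
      simp only [AlgHom.comp_apply, aeval_X, Function.update_self, Ideal.Quotient.mkₐ_eq_mk]
      rw [Ideal.Quotient.eq, ← neg_mem_iff]
      refine Ideal.mem_span_singleton.2 ⟨1, by ring⟩
    · simp [Function.update_of_ne hl]
  have h2 := DFunLike.congr_fun this f
  rw [AlgHom.comp_apply, h, map_zero] at h2
  exact h2.symm

theorem X_add_X_ne_zero {σ : Type*} {i j : σ} (hij : i ≠ j) :
    (X i + X j : MvPolynomial σ ℤ) ≠ 0 := by
  classical
  intro h
  have := congrArg (coeff (Finsupp.single i 1)) h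
  simp [coeff_X, Finsupp.single_left_inj, hij.symm] at this

theorem totalDegree_X_add_X {σ : Type*} {i j : σ} (hij : i ≠ j) :
    1 ≤ (X i + X j : MvPolynomial σ ℤ).totalDegree := by
  classical
  have : Finsupp.single i 1 ∈ (X i + X j : MvPolynomial σ ℤ).support := by
    simp [mem_support_iff, coeff_X, Finsupp.single_left_inj, hij.symm]
  simpa using le_totalDegree this

/-- For odd `p`, `P^p - ∑ X i ^ p` vanishes when two variables are opposite, so the three linear
forms divide it in turn. Comparing degrees bounds `k`. -/
theorem exists_trinomial_pow_prime_eq {p : ℕ} (hp : p.Prime) (hp2 : 2 < p) :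
    ∃ k : MvPolynomial (Fin 3) ℤ, k.totalDegree ≤ p - 3 ∧
      (X 0 + X 1 + X 2 : MvPolynomial (Fin 3) ℤ) ^ p = X 0 ^ p + X 1 ^ p + X 2 ^ p +
        (p : MvPolynomial (Fin 3) ℤ) * ((X 1 + X 2) * (X 2 + X 0) * (X 0 + X 1) * k) := by
  have hodd : Odd p := hp.odd_of_ne_two hp2.ne'
  obtain ⟨a, ha⟩ := exists_add_pow_prime_eq hp (X 0 + X 1 : MvPolynomial (Fin 3) ℤ) (X 2)
  obtain ⟨b, hb⟩ := exists_add_pow_prime_eq hp (X 0 : MvPolynomial (Fin 3) ℤ) (X 1)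
  obtain ⟨h, hh⟩ : ∃ h : MvPolynomial (Fin 3) ℤ,
      (p : MvPolynomial (Fin 3) ℤ) * h = (X 0 + X 1 + X 2) ^ p - (X 0 ^ p + X 1 ^ p + X 2 ^ p) :=
    ⟨(X 0 + X 1) * X 2 * a + X 0 * X 1 * b, by rw [ha, hb]; ring⟩
  have hp0 : (p : MvPolynomial (Fin 3) ℤ) ≠ 0 := by exact_mod_cast hp.ne_zero
  have key : ∀ i j : Fin 3, i ≠ j →
      aeval (Function.update X i (-X j) : Fin 3 → MvPolynomial (Fin 3) ℤ) h = 0 := by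
    intro i j hij
    have h1 := congrArg (aeval (Function.update X i (-X j) : Fin 3 → MvPolynomial (Fin 3) ℤ)) hh
    rw [map_mul, map_natCast] at h1
    refine (mul_eq_zero.1 (h1.trans ?_)).resolve_left hp0
    fin_cases i <;> fin_cases j <;> first | exact absurd rfl hij | skip
    all_goals simp [hodd.neg_pow, Function.update]
  have n01 : (X 0 + X 1 : MvPolynomial (Fin 3) ℤ) ≠ 0 := X_add_X_ne_zero (by decide)
  have n12 : (X 1 + X 2 : MvPolynomial (Fin 3) ℤ) ≠ 0 := X_add_X_ne_zero (by decide)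
  have n20 : (X 2 + X 0 : MvPolynomial (Fin 3) ℤ) ≠ 0 := X_add_X_ne_zero (by decide)
  obtain ⟨h₁, hh₁⟩ := X_add_X_dvd_of_aeval_eq_zero h (key 0 1 (by decide))
  obtain ⟨h₂, hh₂⟩ : X 1 + X 2 ∣ h₁ := by
    refine X_add_X_dvd_of_aeval_eq_zero h₁ ?_
    have := key 1 2 (by decide)
    rw [hh₁, map_mul] at this
    refine (mul_eq_zero.1 this).resolve_left fun h0 => ?_
    -- At `(1, 2, 4)` the substituted factor `X 0 - X 2` is nonzero.
    simpa [Function.update] using congrArg (eval ![1, 2, 4]) h0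
  obtain ⟨k, hk⟩ : X 2 + X 0 ∣ h₂ := by
    refine X_add_X_dvd_of_aeval_eq_zero h₂ ?_
    have := key 2 0 (by decide)
    rw [hh₁, hh₂, map_mul, map_mul] at this
    refine (mul_eq_zero.1 ((mul_eq_zero.1 this).resolve_left fun h0 => ?_)).resolve_left
      fun h0 => ?_
    · simpa [Function.update] using congrArg (eval ![1, 2, 4]) h0
    · simpa [Function.update] using congrArg (eval ![1, 2, 4]) h0
  refine ⟨k, ?_, ?_⟩
  · by_cases k0 : k = 0
    · simp [k0]
    have hd : ((p : MvPolynomial (Fin 3) ℤ) * h).totalDegree ≤ p := by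
      rw [hh]
      have d : ∀ i : Fin 3, (X i ^ p : MvPolynomial (Fin 3) ℤ).totalDegree ≤ p := fun i => by simp
      refine (totalDegree_sub _ _).trans (max_le ((totalDegree_pow _ _).trans ?_) ?_)
      · refine (Nat.mul_le_mul_left p (m := 1) ?_).trans (by simp)
        exact (totalDegree_add _ _).trans (max_le ((totalDegree_add _ _).trans (by simp)) (by simp))
      · exact (totalDegree_add _ _).trans
          (max_le ((totalDegree_add _ _).trans (max_le (d _) (d _))) (d _))
    have d01 := totalDegree_X_add_X (show (0 : Fin 3) ≠ 1 by decide)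
    have d12 := totalDegree_X_add_X (show (1 : Fin 3) ≠ 2 by decide)
    have d20 := totalDegree_X_add_X (show (2 : Fin 3) ≠ 0 by decide)
    rw [hh₁, hh₂, hk, totalDegree_mul_of_isDomain hp0 (by simp_all),
      totalDegree_mul_of_isDomain n01 (by simp_all), totalDegree_mul_of_isDomain n12 (by simp_all),
      totalDegree_mul_of_isDomain n20 k0] at hd
    omega
  · rw [eq_sub_iff_add_eq'] at hh
    rw [← hh, hh₁, hh₂, hk]; ring

/-! ### Coefficients at exponents `-1` modulo `p` -/

theorem geomQuot_neg_mul {R : Type*} [CommRing R] (u v : R) {p : ℕ} (hp : Odd p) :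
    geomQuot u (-v) p * (u + v) = u ^ p + v ^ p := by
  have := geomQuot_mul u (-v) p
  rwa [sub_neg_eq_add, hp.neg_pow, sub_neg_eq_add] at this

theorem totalDegree_geomQuot_neg_le {σ : Type*} (i j : σ) (p : ℕ) :
    (geomQuot (X i) (-X j) p : MvPolynomial σ ℤ).totalDegree ≤ p - 1 := by
  refine totalDegree_finsetSum_le fun l hl => ?_
  rw [Finset.mem_range] at hl
  refine (totalDegree_mul _ _).trans ?_
  have h₁ : (X i ^ l : MvPolynomial σ ℤ).totalDegree = l := totalDegree_X_pow i l
  have h₂ : ((-X j) ^ (p - 1 - l) : MvPolynomial σ ℤ).totalDegree ≤ (p - 1 - l) * 1 := by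
    refine (totalDegree_pow _ _).trans (Nat.mul_le_mul_left _ ?_)
    rw [totalDegree_neg, totalDegree_X]
  omega

/-- Only equal indices `i = j = k` reach this monomial, with sign `(-1)^i`; the alternating sum of
`p` signs is 1. -/
theorem coeff_geomQuot_neg_cyclic {p : ℕ} (hp : Odd p) :
    coeff (tripleExponent (p - 1) (p - 1) (p - 1))
      (geomQuot (X 1) (-X 2) p * geomQuot (X 2) (-X 0) p * geomQuot (X 0) (-X 1) p :
        MvPolynomial (Fin 3) ℤ) = 1 := by
  have hterm : ∀ i ∈ Finset.range p, ∀ j ∈ Finset.range p, ∀ k ∈ Finset.range p,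
      coeff (tripleExponent (p - 1) (p - 1) (p - 1))
        ((X 1 : MvPolynomial (Fin 3) ℤ) ^ i * (-X 2) ^ (p - 1 - i) *
          (X 2 ^ j * (-X 0) ^ (p - 1 - j)) * (X 0 ^ k * (-X 1) ^ (p - 1 - k))) =
      if k = j then if j = i then (-1) ^ i else 0 else 0 := by
    intro i hi j hj k hk
    rw [Finset.mem_range] at hi hj hk
    have : ((X 1 : MvPolynomial (Fin 3) ℤ) ^ i * (-X 2) ^ (p - 1 - i) *
          (X 2 ^ j * (-X 0) ^ (p - 1 - j)) * (X 0 ^ k * (-X 1) ^ (p - 1 - k))) =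
        C ((-1) ^ (p - 1 - i + (p - 1 - j) + (p - 1 - k))) *
          monomial (tripleExponent (k + (p - 1 - j)) (i + (p - 1 - k)) (j + (p - 1 - i))) 1 := by
      rw [monomial_tripleExponent, neg_pow (X 0 : MvPolynomial (Fin 3) ℤ),
        neg_pow (X 1 : MvPolynomial (Fin 3) ℤ), neg_pow (X 2 : MvPolynomial (Fin 3) ℤ)]
      simp only [C_pow, C_neg, C_1]
      ring
    rw [this, coeff_C_mul, coeff_monomial]
    by_cases h : k = j ∧ j = i
    · obtain ⟨rfl, rfl⟩ := h
      rw [if_pos (by rw [tripleExponent_inj]; omega), if_pos rfl, if_pos rfl, mul_one]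
      obtain ⟨q, rfl⟩ := hp
      rcases Nat.even_or_odd k with he | ho
      · rw [he.neg_one_pow, Even.neg_one_pow]
        grind
      · rw [ho.neg_one_pow, Odd.neg_one_pow]
        grind
    · rw [if_neg (by rw [tripleExponent_inj]; omega), mul_zero]
      split_ifs <;> first | rfl | exact absurd ⟨‹_›, ‹_›⟩ h
  simp only [geomQuot, sum_mul_sum_mul_sum, coeff_sum]
  rw [Finset.sum_congr rfl fun i hi => Finset.sum_congr rfl fun j hj =>
    Finset.sum_congr rfl fun k hk => hterm i hi j hj k hk]
  simpa +contextual [Finset.sum_ite_eq', neg_one_geom_sum] using hp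

/-- At exponents `≡ -1` modulo `p`, only the coefficient of `∏ X i ^ (p - 1)` in a low degree factor
`g` contributes to `F(X ^ p) * g`. -/
theorem coeff_expand_mul_of_totalDegree_le {σ : Type*} [Fintype σ] {p : ℕ} (hp : 0 < p)
    (F g : MvPolynomial σ ℤ) (n m₀ : σ →₀ ℕ) (hm₀ : ∀ i, m₀ i = p - 1)
    (hg : g.totalDegree ≤ Fintype.card σ * (p - 1)) :
    coeff (p • n + m₀) (expand p F * g) = coeff n F * coeff m₀ g := by
  classical
  rw [coeff_mul, Finset.sum_eq_single (p • n, m₀)]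
  · rw [coeff_expand_smul (hp := hp.ne')]
  · rintro ⟨a, b⟩ hab hne
    rw [Finset.HasAntidiagonal.mem_antidiagonal] at hab
    by_cases ha : ∀ i, p ∣ a i
    · rw [coeff_eq_zero_of_totalDegree_lt (f := g), mul_zero]
      refine hg.trans_lt ?_
      change _ < b.degree
      rw [Finsupp.degree_eq_sum, ← smul_eq_mul, ← Finset.card_univ, ← Finset.sum_const]
      -- `p ∣ a i` forces `b i ≡ -1` modulo `p`.
      have hle : ∀ i, p - 1 ≤ b i := fun i => by
        have h1 : p ∣ a i + (b i + 1) := by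
          have := DFunLike.congr_fun hab i
          simp only [Finsupp.add_apply, Finsupp.smul_apply, smul_eq_mul, hm₀] at this
          rw [← add_assoc, this, add_assoc, Nat.sub_add_cancel hp]
          exact dvd_add (dvd_mul_right _ _) dvd_rfl
        have := Nat.le_of_dvd (Nat.succ_pos _) ((Nat.dvd_add_right (ha i)).1 h1)
        omega
      refine Finset.sum_lt_sum (fun i _ => hle i) ?_
      by_contra! hall
      have hb : b = m₀ := by
        ext i
        rw [hm₀]
        exact le_antisymm (hall i (Finset.mem_univ _)) (hle i)
      subst hb
      exact hne (Prod.ext (add_right_cancel hab) rfl)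
    · push Not at ha
      obtain ⟨i, hi⟩ := ha
      exact mul_eq_zero_of_left (coeff_expand_of_not_dvd F hi) _
  · intro h
    rw [Finset.HasAntidiagonal.mem_antidiagonal] at h
    exact absurd rfl h

/-! ### Assembly -/

/-- Split `P^(rp) - x^(rp)` as `((P^p)^r - e^r) + (e^r - (x^p)^r)` and cancel `y + z`. -/
theorem geomQuot_mul_eq {R : Type*} [CommRing R] [IsDomain R] {p : ℕ} (hp : Odd p)
    {x y z P e a k : R} (hP : P - x = y + z) (he : e - x ^ p = y ^ p + z ^ p)
    (hPp : P ^ p = e + p * ((y + z) * a * k)) (h0 : y + z ≠ 0) (r : ℕ) :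
    geomQuot P x (r * p) =
      geomQuot e (x ^ p) r * geomQuot y (-z) p + p * a * k * geomQuot (P ^ p) e r := by
  refine mul_right_cancel₀ h0 ?_
  have h₁ := geomQuot_mul P x (r * p)
  have h₂ := geomQuot_mul e (x ^ p) r
  have h₃ := geomQuot_mul (P ^ p) e r
  have h₄ := geomQuot_neg_mul y z hp
  rw [hP, mul_comm r p, pow_mul, pow_mul] at h₁
  rw [mul_comm r p]
  linear_combination h₁ - h₂ - h₃ - geomQuot e (x ^ p) r * h₄ + geomQuot e (x ^ p) r * he
    + geomQuot (P ^ p) e r * hPp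

theorem theorem1 (p : ℕ) (hp : p.Prime) (hp2 : 2 < p) (r s t : ℕ)
    (hr : 0 < r) (hs : 0 < s) (ht : 0 < t) :
    (∑ m₁ ∈ Finset.range (r * p), ∑ m₂ ∈ Finset.range (s * p), ∑ m₃ ∈ Finset.range (t * p),
        Nat.multinomial Finset.univ ![m₁, m₂, m₃])
      ≡ (∑ m₁ ∈ Finset.range r, ∑ m₂ ∈ Finset.range s, ∑ m₃ ∈ Finset.range t,
        Nat.multinomial Finset.univ ![m₁, m₂, m₃]) [MOD p ^ 3] := by
  rw [← Int.natCast_modEq_iff]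
  push_cast
  rw [← coeff_geomQuot_eq_sum_multinomial, ← coeff_geomQuot_eq_sum_multinomial]
  have hodd : Odd p := hp.odd_of_ne_two hp2.ne'
  obtain ⟨k, hk, hkp⟩ := exists_trinomial_pow_prime_eq hp hp2
  have n01 : (X 0 + X 1 : MvPolynomial (Fin 3) ℤ) ≠ 0 := X_add_X_ne_zero (by decide)
  have n12 : (X 1 + X 2 : MvPolynomial (Fin 3) ℤ) ≠ 0 := X_add_X_ne_zero (by decide)
  have n20 : (X 2 + X 0 : MvPolynomial (Fin 3) ℤ) ≠ 0 := X_add_X_ne_zero (by decide)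
  set P : MvPolynomial (Fin 3) ℤ := X 0 + X 1 + X 2 with hP
  set e : MvPolynomial (Fin 3) ℤ := X 0 ^ p + X 1 ^ p + X 2 ^ p with he
  set u : MvPolynomial (Fin 3) ℤ := X 1 + X 2 with hu
  set v : MvPolynomial (Fin 3) ℤ := X 2 + X 0 with hv
  set w : MvPolynomial (Fin 3) ℤ := X 0 + X 1 with hw
  set h : MvPolynomial (Fin 3) ℤ := u * v * w * k with hh
  have heP : expand p P = e := by simp [hP, he, hw]
  have hq (i : Fin 3) (n : ℕ) : geomQuot e (X i ^ p) n = expand p (geomQuot P (X i) n) := by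
    have := map_geomQuot (expand p : MvPolynomial (Fin 3) ℤ →ₐ[ℤ] _).toRingHom P (X i) n
    simp only [AlgHom.toRingHom_eq_coe, RingHom.coe_coe, heP, expand_X] at this
    exact this.symm
  have hQ₁ : geomQuot P (X 0) (r * p) = expand p (geomQuot P (X 0) r) * geomQuot (X 1) (-X 2) p +
      (p : MvPolynomial (Fin 3) ℤ) * (v * w) * k * geomQuot (P ^ p) e r := by
    rw [← hq]
    exact geomQuot_mul_eq hodd (by simp only [hP, hw]; ring) (by rw [he]; ring) (by rw [hkp, hh]; ring) n12 r
  have hQ₂ : geomQuot P (X 1) (s * p) = expand p (geomQuot P (X 1) s) * geomQuot (X 2) (-X 0) p +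
      (p : MvPolynomial (Fin 3) ℤ) * (u * w) * k * geomQuot (P ^ p) e s := by
    rw [← hq]
    exact geomQuot_mul_eq hodd (by simp only [hP, hw]; ring) (by rw [he]; ring) (by rw [hkp, hh]; ring) n20 s
  have hQ₃ : geomQuot P (X 2) (t * p) = expand p (geomQuot P (X 2) t) * geomQuot (X 0) (-X 1) p +
      (p : MvPolynomial (Fin 3) ℤ) * (u * v) * k * geomQuot (P ^ p) e t := by
    rw [← hq]
    exact geomQuot_mul_eq hodd (by simp only [hP, hw]; ring) (by rw [he]; ring) (by rw [hkp, hh]; ring) n01 t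
  have hg (n : ℕ) : ∃ A B C, geomQuot (P ^ p) e n =
      expand p A + (p : MvPolynomial (Fin 3) ℤ) * h * expand p B + (p : MvPolynomial (Fin 3) ℤ) ^ 2 * C := by
    obtain ⟨_, ⟨A, rfl⟩, _, ⟨B, rfl⟩, C, hC⟩ := exists_geomQuot_expansion
      (expand p : MvPolynomial (Fin 3) ℤ →ₐ[ℤ] _).toRingHom.range (e := e) ⟨P, heP⟩ (p * h) n
    refine ⟨A, B, h ^ 2 * C, ?_⟩
    rw [hkp, hC]
    simp only [AlgHom.toRingHom_eq_coe, RingHom.coe_coe]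
    ring
  obtain ⟨A₁, B₁, C₁, hg₁⟩ := hg r
  obtain ⟨A₂, B₂, C₂, hg₂⟩ := hg s
  obtain ⟨A₃, B₃, C₃, hg₃⟩ := hg t
  have hU : expand p u = geomQuot (X 1) (-X 2) p * u := by
    rw [geomQuot_neg_mul _ _ hodd]; simp [hu]
  have hV : expand p v = geomQuot (X 2) (-X 0) p * v := by
    rw [geomQuot_neg_mul _ _ hodd]; simp [hv]
  have hW : expand p w = geomQuot (X 0) (-X 1) p * w := by
    rw [geomQuot_neg_mul _ _ hodd]; simp [hw]
  obtain ⟨T, hid⟩ := exists_product_expansion_mod_cube (p : MvPolynomial (Fin 3) ℤ) u v w k _ _ _ _ _ _ _ _ _ _ _ _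
    _ _ _ h _ _ _ _ _ _ hh hU hV hW hg₁ hg₂ hg₃
  rw [← hQ₁, ← hQ₂, ← hQ₃] at hid
  obtain ⟨G₁, G₂, hGT⟩ : ∃ G₁ G₂ : MvPolynomial (Fin 3) ℤ,
      geomQuot P (X 0) (r * p) * geomQuot P (X 1) (s * p) * geomQuot P (X 2) (t * p) =
      expand p (geomQuot P (X 0) r * geomQuot P (X 1) s * geomQuot P (X 2) t) *
        (geomQuot (X 1) (-X 2) p * geomQuot (X 2) (-X 0) p * geomQuot (X 0) (-X 1) p) +
      expand p G₁ * k + expand p G₂ * (k * h) + C ((p : ℤ) ^ 3) * T := by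
    refine ⟨p * (geomQuot P (X 1) s * geomQuot P (X 2) t * v * w * A₁ +
        geomQuot P (X 0) r * geomQuot P (X 2) t * u * w * A₂ +
        geomQuot P (X 0) r * geomQuot P (X 1) s * u * v * A₃),
      p ^ 2 * (geomQuot P (X 1) s * geomQuot P (X 2) t * v * w * B₁ +
        geomQuot P (X 0) r * geomQuot P (X 2) t * u * w * B₂ +
        geomQuot P (X 0) r * geomQuot P (X 1) s * u * v * B₃ +
        geomQuot P (X 2) t * w * A₁ * A₂ + geomQuot P (X 1) s * v * A₁ * A₃ +
        geomQuot P (X 0) r * u * A₂ * A₃), hid.trans ?_⟩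
    simp only [map_mul, map_add, map_pow, map_natCast]
  -- Positivity matters: `a * p - 1 = p * (a - 1) + (p - 1)` fails at `a = 0` under truncated
  -- subtraction.
  have hm (a b c : ℕ) (ha : 0 < a) (hb : 0 < b) (hc : 0 < c) :
      tripleExponent (a * p - 1) (b * p - 1) (c * p - 1) =
      p • tripleExponent (a - 1) (b - 1) (c - 1) + tripleExponent (p - 1) (p - 1) (p - 1) := by
    have key (a : ℕ) (ha : 0 < a) : a * p - 1 = p * (a - 1) + (p - 1) := by
      obtain ⟨a, rfl⟩ : ∃ b, a = b + 1 := ⟨a - 1, by omega⟩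
      have := hp.pos
      rw [Nat.add_sub_cancel, add_one_mul, mul_comm]
      omega
    ext i
    fin_cases i <;> simp [tripleExponent, *]
  have hm₀ (i : Fin 3) : tripleExponent (p - 1) (p - 1) (p - 1) i = p - 1 := by
    fin_cases i <;> simp [tripleExponent]
  have hcoeff (F g : MvPolynomial (Fin 3) ℤ) (hgd : g.totalDegree ≤ 3 * (p - 1)) :
      coeff (tripleExponent (r * p - 1) (s * p - 1) (t * p - 1)) (expand p F * g) =
      coeff (tripleExponent (r - 1) (s - 1) (t - 1)) F *
        coeff (tripleExponent (p - 1) (p - 1) (p - 1)) g := by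
    rw [hm r s t hr hs ht]
    exact coeff_expand_mul_of_totalDegree_le hp.pos F g _ _ hm₀ (by simpa using hgd)
  have hzero (g : MvPolynomial (Fin 3) ℤ) (hgd : g.totalDegree < 3 * (p - 1)) :
      coeff (tripleExponent (p - 1) (p - 1) (p - 1)) g = 0 := by
    refine coeff_eq_zero_of_totalDegree_lt (hgd.trans_le (le_of_eq ?_))
    change _ = (tripleExponent (p - 1) (p - 1) (p - 1)).degree
    simp [Finsupp.degree_eq_sum, hm₀]
  have hXX (i j : Fin 3) : (X i + X j : MvPolynomial (Fin 3) ℤ).totalDegree ≤ 1 :=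
    (totalDegree_add _ _).trans (by simp)
  -- `2 * (p - 3) + 3 = 2 * p - 3`, below the degree `3 * (p - 1)` needed to contribute.
  have hkh : (k * h).totalDegree ≤ 2 * p - 3 := by
    have := totalDegree_mul k h
    have := totalDegree_mul (u * v * w) k
    rw [← hh] at this
    have := totalDegree_mul (u * v) w
    have := totalDegree_mul u v
    have : u.totalDegree ≤ 1 := hXX 1 2
    have : v.totalDegree ≤ 1 := hXX 2 0
    have : w.totalDegree ≤ 1 := hXX 0 1
    omega
  have hccc : (geomQuot (X 1) (-X 2) p * geomQuot (X 2) (-X 0) p * geomQuot (X 0) (-X 1) p :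
      MvPolynomial (Fin 3) ℤ).totalDegree ≤ 3 * (p - 1) := by
    refine (totalDegree_mul _ _).trans ((add_le_add_left (totalDegree_mul _ _) _).trans ?_)
    have := totalDegree_geomQuot_neg_le (1 : Fin 3) 2 p
    have := totalDegree_geomQuot_neg_le (2 : Fin 3) 0 p
    have := totalDegree_geomQuot_neg_le (0 : Fin 3) 1 p
    omega
  rw [hGT, coeff_add, coeff_add, coeff_add, hcoeff _ _ hccc, hcoeff _ _ (by omega),
    hcoeff _ _ (by omega), hzero k (by omega), hzero (k * h) (by omega),
    coeff_geomQuot_neg_cyclic hodd, coeff_C_mul, mul_one, mul_zero, mul_zero, add_zero, add_zero]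
  exact Int.modEq_iff_dvd.2 ⟨-coeff _ T, by ring⟩
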